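/- Let $G$ be a finite simple graph on $n$ vertices with at least one edge, let $k$ be a field, let $S$ be the polynomial ring over $k$ whose variables are the vertices of $G$, and let $I(G)=(xy : (x,y)\text{ is an edge of }G)\subseteq S$ be the edge ideal of $G$. Let $C$ be the maximum of $\deg(x)+\left\lfloor \frac{\deg(y)}{2}\right\rfloor+1$ over all ordered pairs $(x,y)$ of adjacent vertices of $G$. If $G$ is claw-free, that is, if no induced subgraph of $G$ is isomorphic to the complete bipartite graph $K_{1,3}$, then the projective dimension of the $S$-module $S/I(G)$ is finite and satisfies $$\operatorname{pd}(S/I(G)) \le n\left(1-\frac{1}{C}\right).$$ -/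

import Mathlib

/-- The claw, i.e. the complete bipartite graph with parts of sizes `1` and `3`. -/
abbrev clawGraph : SimpleGraph (Fin 1 ⊕ Fin 3) :=
  completeBipartiteGraph (Fin 1) (Fin 3)

/-- A graph is claw-free if no induced subgraph of it is isomorphic to the claw. -/
def IsClawFree {V : Type*} (G : SimpleGraph V) : Prop :=
  ¬ clawGraph.IsIndContained G

/-- The edge ideal of `G` over `k`: the ideal of the polynomial ring on the vertices of `G`
generated by the products `x y` over the edges `(x, y)` of `G`. -/
noncomputable def edgeIdeal (k : Type*) [Field k] {V : Type*} (G : SimpleGraph V) :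
    Ideal (MvPolynomial V k) :=
  Ideal.span {f | ∃ x y : V, G.Adj x y ∧ f = MvPolynomial.X x * MvPolynomial.X y}

/-- The projective dimension of the module `S ⧸ I(G)` over the polynomial ring `S` on the vertices
of `G`, with values in `WithBot ℕ∞` (`⊥` only for the zero module). -/
noncomputable def edgeIdealQuotientPD (k : Type*) [Field k] {V : Type*} (G : SimpleGraph V) :
    WithBot ℕ∞ :=
  CategoryTheory.projectiveDimension
    (ModuleCat.of (MvPolynomial V k) (MvPolynomial V k ⧸ edgeIdeal k G))

/-- The set of the numbers `deg x + ⌊deg y / 2⌋ + 1`, where `(x, y)` runs over all ordered pairs of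
adjacent vertices of `G` (the division is that of natural numbers, so it rounds down). -/
def edgeDegreeValues {V : Type*} [Fintype V] (G : SimpleGraph V) [DecidableRel G.Adj] : Set ℕ :=
  {c | ∃ x y : V, G.Adj x y ∧ c = G.degree x + G.degree y / 2 + 1}

open CategoryTheory MvPolynomial

/-! Split along variables: for a variable `x`, the projective dimension of `S ⧸ I` is at most the
larger of those of `S ⧸ (I : x)` and `S ⧸ (I + (x))`. A state is a pair `(W, A)`: edges survive
inside `W`, the variables in `A` lie in the ideal, and all other vertices are free. A colon step
frees a vertex, lowering `|A| + |W|` by one. If it costs `W` at most `C` vertices, the potential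
`|A| + |W| (1 - 1/C)` does not increase; with no edges left, the projective dimension is at most
`|A|`.

To ensure this cost, the neighbours of some `y` are deleted one by one until `y` is isolated, hence
free. Claw-freeness forbids three independent neighbours of `y`, so in any set `S` of neighbours
some `z` misses at most `|S| / 2` others. Making `z` the last of `S` to be deleted, the colon by `z`
loses at most `deg z + ⌊deg y / 2⌋ + 1 ≤ C` vertices (`partialEdgeIdealPDLE_of_delete_nbrs`). -/

/-! ### Projective dimension along colon sequences -/

/-- The short exact sequence `0 → R ⧸ (I : a) → R ⧸ I → R ⧸ (I + (a)) → 0`. -/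
theorem exists_colon_shortExact {R : Type*} [CommRing R] {I J K : Ideal R} (a : R)
    (hJ : ∀ f, f ∈ J ↔ a * f ∈ I) (hK : K = I ⊔ Ideal.span {a}) :
    ∃ S : ShortComplex (ModuleCat R), S.ShortExact ∧ S.X₁ = ModuleCat.of R (R ⧸ J) ∧
      S.X₂ = ModuleCat.of R (R ⧸ I) ∧ S.X₃ = ModuleCat.of R (R ⧸ K) := by
  have hIK : I ≤ K := hK ▸ le_sup_left
  let f : (R ⧸ J) →ₗ[R] (R ⧸ I) :=
    Submodule.mapQ J I (LinearMap.mulLeft R a) fun x hx => (hJ x).1 hx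
  let g : (R ⧸ I) →ₗ[R] (R ⧸ K) := Submodule.factor hIK
  have hf (x : R) : f (Submodule.Quotient.mk x) = Submodule.Quotient.mk (a * x) := rfl
  have hg (x : R) : g (Submodule.Quotient.mk x) = Submodule.Quotient.mk x := rfl
  have hfinj : Function.Injective f := by
    rw [injective_iff_map_eq_zero]
    intro x
    obtain ⟨x, rfl⟩ := Submodule.Quotient.mk_surjective _ x
    rw [hf, Submodule.Quotient.mk_eq_zero, Submodule.Quotient.mk_eq_zero, hJ]
    exact id
  have hgsurj : Function.Surjective g := by
    intro x
    obtain ⟨x, rfl⟩ := Submodule.Quotient.mk_surjective _ x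
    exact ⟨Submodule.Quotient.mk x, hg x⟩
  have hfg : Function.Exact f g := by
    intro x
    obtain ⟨x, rfl⟩ := Submodule.Quotient.mk_surjective _ x
    rw [hg, Submodule.Quotient.mk_eq_zero, hK, Submodule.mem_sup]
    constructor
    · rintro ⟨i, hi, z, hz, rfl⟩
      obtain ⟨c, rfl⟩ := Ideal.mem_span_singleton'.1 hz
      refine ⟨Submodule.Quotient.mk c, ?_⟩
      rw [hf, Submodule.Quotient.eq]
      convert I.neg_mem hi using 1
      ring
    · rintro ⟨c, hc⟩
      obtain ⟨c, rfl⟩ := Submodule.Quotient.mk_surjective _ c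
      rw [hf, Submodule.Quotient.eq] at hc
      exact ⟨x - a * c, by simpa using I.neg_mem hc, a * c,
        Ideal.mul_mem_right _ _ (Ideal.mem_span_singleton_self a), by ring⟩
  have hzero : g ∘ₗ f = 0 := hfg.linearMap_comp_eq_zero
  exact ⟨ShortComplex.mk (ModuleCat.ofHom f) (ModuleCat.ofHom g)
    (by rw [← ModuleCat.ofHom_comp, hzero]; rfl),
    ModuleCat.shortComplex_shortExact _ hfg hfinj hgsurj, rfl, rfl, rfl⟩

theorem hasProjectiveDimensionLT_quotient_of_colon {R : Type*} [CommRing R] {I J K : Ideal R}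
    (a : R) (hJ : ∀ f, f ∈ J ↔ a * f ∈ I) (hK : K = I ⊔ Ideal.span {a}) {n : ℕ}
    (h₁ : HasProjectiveDimensionLT (ModuleCat.of R (R ⧸ J)) n)
    (h₃ : HasProjectiveDimensionLT (ModuleCat.of R (R ⧸ K)) n) :
    HasProjectiveDimensionLT (ModuleCat.of R (R ⧸ I)) n := by
  obtain ⟨S, hS, e₁, e₂, e₃⟩ := exists_colon_shortExact a hJ hK
  rw [← e₁] at h₁
  rw [← e₃] at h₃
  rw [← e₂]
  exact hS.hasProjectiveDimensionLT_X₂ n h₁ h₃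

/-- By `hI`, `a` is a nonzerodivisor modulo `I`, so the first two terms of the colon sequence are
both `R ⧸ I`. -/
theorem hasProjectiveDimensionLT_quotient_sup_span {R : Type*} [CommRing R] {I K : Ideal R}
    (a : R) (hI : ∀ f, f ∈ I ↔ a * f ∈ I) (hK : K = I ⊔ Ideal.span {a}) {n : ℕ}
    (h : HasProjectiveDimensionLT (ModuleCat.of R (R ⧸ I)) n) :
    HasProjectiveDimensionLT (ModuleCat.of R (R ⧸ K)) (n + 1) := by
  obtain ⟨S, hS, e₁, e₂, e₃⟩ := exists_colon_shortExact a hI hK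
  rw [← e₃]
  exact hS.hasProjectiveDimensionLT_X₃ n (e₁ ▸ h)
    (e₂ ▸ hasProjectiveDimensionLT_of_ge _ n (n + 1) n.le_succ)

/-! ### Colons and sums of monomial ideals, read off exponents -/

section MonomialIdeal

variable {V : Type*} (k : Type*) [Field k]

theorem mem_restrictSupportIdeal_iff {s : Set (V →₀ ℕ)} (hs : IsUpperSet s)
    (p : MvPolynomial V k) :
    p ∈ restrictSupportIdeal (R := k) s hs ↔ ∀ m ∈ p.support, m ∈ s :=
  Iff.rfl

theorem mem_restrictSupportIdeal_colon_X {s t : Set (V →₀ ℕ)} (hs : IsUpperSet s)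
    (ht : IsUpperSet t) (x : V) (h : ∀ m, m ∈ t ↔ Finsupp.single x 1 + m ∈ s)
    (p : MvPolynomial V k) :
    p ∈ restrictSupportIdeal (R := k) t ht ↔ X x * p ∈ restrictSupportIdeal (R := k) s hs := by
  classical
  simp only [mem_restrictSupportIdeal_iff, support_X_mul, Finset.mem_map,
    addLeftEmbedding_apply, forall_exists_index, and_imp, forall_apply_eq_imp_iff₂, h]

theorem restrictSupportIdeal_sup_span_X {s t : Set (V →₀ ℕ)} (hs : IsUpperSet s)
    (ht : IsUpperSet t) (x : V) (h : ∀ m, m ∈ t ↔ m ∈ s ∨ m x ≠ 0) :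
    restrictSupportIdeal (R := k) t ht =
      restrictSupportIdeal (R := k) s hs ⊔ Ideal.span {X x} := by
  classical
  apply le_antisymm
  · intro p hp
    rw [mem_restrictSupportIdeal_iff] at hp
    rw [p.as_sum]
    refine Ideal.sum_mem _ fun m hm => ?_
    rcases (h m).1 (hp m hm) with hms | hmx
    · refine Ideal.mem_sup_left ?_
      rw [mem_restrictSupportIdeal_iff]
      intro m' hm'
      rwa [Finset.mem_singleton.1 (support_monomial_subset hm')]
    · refine Ideal.mem_sup_right (Ideal.mem_span_singleton.2 ?_)
      exact X_dvd_monomial.2 (Or.inr hmx)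
  · refine sup_le ?_ ?_
    · intro p hp
      rw [mem_restrictSupportIdeal_iff] at hp ⊢
      exact fun m hm => (h m).2 (Or.inl (hp m hm))
    · rw [Ideal.span_singleton_le_iff_mem, mem_restrictSupportIdeal_iff]
      intro m hm
      rw [support_X, Finset.mem_singleton] at hm
      exact (h m).2 (Or.inr (by simp [hm]))

end MonomialIdeal

/-! ### The states `(W, A)` and their splitting -/

section EdgeSupport

variable {V : Type*} (G : SimpleGraph V)

/-- The exponents of the monomials in the ideal generated by the variables in `A` and by the edges
of `G` inside `W`. -/
def edgeSupport (W A : Finset V) : Set (V →₀ ℕ) :=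
  {m | (∃ a ∈ A, m a ≠ 0) ∨ ∃ u ∈ W, ∃ v ∈ W, G.Adj u v ∧ m u ≠ 0 ∧ m v ≠ 0}

theorem isUpperSet_edgeSupport (W A : Finset V) : IsUpperSet (edgeSupport G W A) := by
  have key {m m' : V →₀ ℕ} (h : m ≤ m') {a : V} (ha : m a ≠ 0) : m' a ≠ 0 := by
    have := h a
    omega
  rintro m m' h (⟨a, ha, h1⟩ | ⟨u, hu, v, hv, huv, h1, h2⟩)
  · exact Or.inl ⟨a, ha, key h h1⟩
  · exact Or.inr ⟨u, hu, v, hv, huv, key h h1, key h h2⟩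

/-- The ideal generated by the variables in `A` and by the edges of `G` inside `W`. -/
noncomputable def partialEdgeIdeal (k : Type*) [Field k] (W A : Finset V) :
    Ideal (MvPolynomial V k) :=
  restrictSupportIdeal (R := k) (edgeSupport G W A) (isUpperSet_edgeSupport G W A)

variable (k : Type*) [Field k]

theorem edgeIdeal_eq_partialEdgeIdeal [Fintype V] :
    edgeIdeal k G = partialEdgeIdeal G k Finset.univ ∅ := by
  classical
  apply le_antisymm
  · rw [edgeIdeal, Ideal.span_le]
    rintro _ ⟨x, y, hxy, rfl⟩
    refine (mem_restrictSupportIdeal_iff k _ _).2 fun m hm => ?_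
    rw [support_X_mul, support_X, Finset.map_singleton, Finset.mem_singleton] at hm
    exact Or.inr ⟨x, Finset.mem_univ _, y, Finset.mem_univ _, hxy, by simp [hm], by simp [hm]⟩
  · intro p hp
    rw [p.as_sum]
    refine Ideal.sum_mem _ fun m hm => ?_
    obtain ⟨a, ha, -⟩ | ⟨u, -, v, -, huv, hmu, hmv⟩ :=
      (mem_restrictSupportIdeal_iff k _ _).1 hp m hm
    · simp at ha
    · have hle : Finsupp.single u 1 + Finsupp.single v 1 ≤ m := by
        intro w
        have := huv.ne
        by_cases h1 : u = w <;> by_cases h2 : v = w <;>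
          simp_all [Nat.one_le_iff_ne_zero]
      refine Ideal.mem_of_dvd _ ?_ (Ideal.subset_span ⟨u, v, huv, rfl⟩)
      rw [X, X, monomial_mul, monomial_dvd_monomial]
      exact ⟨Or.inr hle, by simp⟩

/-- The quotient by `partialEdgeIdeal G k W A` has projective dimension at most `n`. -/
def PartialEdgeIdealPDLE (W A : Finset V) (n : ℕ) : Prop :=
  HasProjectiveDimensionLE
    (ModuleCat.of (MvPolynomial V k) (MvPolynomial V k ⧸ partialEdgeIdeal G k W A)) n

theorem partialEdgeIdeal_congr {W A W' A' : Finset V}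
    (h : edgeSupport G W A = edgeSupport G W' A') :
    partialEdgeIdeal G k W A = partialEdgeIdeal G k W' A' := by
  simp only [partialEdgeIdeal, h]

theorem partialEdgeIdealPDLE_congr {W A W' A' : Finset V} {n : ℕ}
    (h : edgeSupport G W A = edgeSupport G W' A') :
    PartialEdgeIdealPDLE G k W A n ↔ PartialEdgeIdealPDLE G k W' A' n := by
  rw [PartialEdgeIdealPDLE, PartialEdgeIdealPDLE, partialEdgeIdeal_congr G k h]

theorem PartialEdgeIdealPDLE.mono {W A : Finset V} {m n : ℕ} (hmn : m ≤ n)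
    (h : PartialEdgeIdealPDLE G k W A m) : PartialEdgeIdealPDLE G k W A n := by
  have : HasProjectiveDimensionLT _ (m + 1) := h
  exact hasProjectiveDimensionLT_of_ge _ (m + 1) (n + 1) (by omega)

/-- The variables in `A` form a regular sequence: each new one is a nonzerodivisor modulo the
others. -/
theorem partialEdgeIdealPDLE_empty (A : Finset V) : PartialEdgeIdealPDLE G k ∅ A A.card := by
  classical
  induction A using Finset.induction_on with
  | empty =>
    have hbot : partialEdgeIdeal G k ∅ ∅ = ⊥ := by
      rw [eq_bot_iff]
      intro p hp
      have hp' := (mem_restrictSupportIdeal_iff k _ _).1 hp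
      rw [Ideal.mem_bot, ← support_eq_empty, Finset.eq_empty_iff_forall_notMem]
      intro m hm
      simpa [edgeSupport] using hp' m hm
    have : Module.Projective (MvPolynomial V k)
        (MvPolynomial V k ⧸ partialEdgeIdeal G k ∅ ∅) := by
      rw [hbot]
      exact Module.Projective.of_equiv (Submodule.quotEquivOfEqBot _ rfl).symm
    exact (projective_iff_hasProjectiveDimensionLE_zero _).1
      (ModuleCat.projective_of_categoryTheory_projective _)
  | insert x A hx ih =>
    rw [Finset.card_insert_of_notMem hx]
    refine hasProjectiveDimensionLT_quotient_sup_span (X x)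
      (mem_restrictSupportIdeal_colon_X k _ _ x ?_) (restrictSupportIdeal_sup_span_X k _ _ x ?_) ih
    · intro m
      simp only [edgeSupport, Finset.notMem_empty, false_and, exists_false, or_false,
        Set.mem_ofPred_eq]
      refine exists_congr fun a => and_congr_right fun ha => ?_
      have : x ≠ a := by rintro rfl; exact hx ha
      simp [this]
    · intro m
      simp [edgeSupport, or_comm]

theorem partialEdgeIdealPDLE_of_no_edges {W A : Finset V}
    (h : ∀ u ∈ W, ∀ v ∈ W, ¬ G.Adj u v) : PartialEdgeIdealPDLE G k W A A.card := by
  refine (partialEdgeIdealPDLE_congr G k ?_).1 (partialEdgeIdealPDLE_empty G k A)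
  ext m
  simp only [edgeSupport, Set.mem_ofPred_eq]
  refine or_congr_right ⟨by simp, ?_⟩
  rintro ⟨u, hu, v, hv, huv, -⟩
  exact absurd huv (h u hu v hv)

variable [DecidableEq V] [DecidableRel G.Adj]

/-- In the colon, the neighbours of `x` in `W` become variables and absorb the edges they meet,
while `x` itself becomes free. If `x` were in `A`, the colon would be the unit ideal. -/
theorem partialEdgeIdealPDLE_of_mem {W A : Finset V} {x : V} (hx : x ∈ W) (hxA : x ∉ A) {n : ℕ}
    (h₁ : PartialEdgeIdealPDLE G k (W.filter fun w => w ≠ x ∧ ¬ G.Adj x w)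
      (A ∪ W.filter (G.Adj x)) n)
    (h₃ : PartialEdgeIdealPDLE G k (W.erase x) (insert x A) n) :
    PartialEdgeIdealPDLE G k W A n := by
  refine hasProjectiveDimensionLT_quotient_of_colon (X x)
    (mem_restrictSupportIdeal_colon_X k _ _ x ?_) (restrictSupportIdeal_sup_span_X k _ _ x ?_) h₁ h₃
  · intro m
    have key (a : V) : (Finsupp.single x 1 + m : V →₀ ℕ) a ≠ 0 ↔ a = x ∨ m a ≠ 0 := by
      by_cases h : x = a <;> simp [h, eq_comm]
    simp only [edgeSupport, Set.mem_ofPred_eq, key]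
    constructor
    · rintro (⟨a, ha, hma⟩ | ⟨u, hu, v, hv, huv, h1, h2⟩)
      · rcases Finset.mem_union.1 ha with ha | ha
        · exact Or.inl ⟨a, ha, Or.inr hma⟩
        · rw [Finset.mem_filter] at ha
          exact Or.inr ⟨x, hx, a, ha.1, ha.2, Or.inl rfl, Or.inr hma⟩
      · exact Or.inr ⟨u, Finset.mem_of_mem_filter u hu, v, Finset.mem_of_mem_filter v hv, huv,
          Or.inr h1, Or.inr h2⟩
    · have nbr {a : V} (ha : a ∈ W) (hxa : G.Adj x a) (hma : m a ≠ 0) :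
          ∃ a ∈ A ∪ W.filter (G.Adj x), m a ≠ 0 :=
        ⟨a, Finset.mem_union_right _ (Finset.mem_filter.2 ⟨ha, hxa⟩), hma⟩
      rintro (⟨a, ha, rfl | hma⟩ | ⟨u, hu, v, hv, huv, h1, h2⟩)
      · exact absurd ha hxA
      · exact Or.inl ⟨a, Finset.mem_union_left _ ha, hma⟩
      · rcases eq_or_ne u x with rfl | hux
        · exact Or.inl (nbr hv huv (h2.resolve_left huv.ne'))
        rcases eq_or_ne v x with rfl | hvx
        · exact Or.inl (nbr hu huv.symm (h1.resolve_left hux))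
        replace h1 := h1.resolve_left hux
        replace h2 := h2.resolve_left hvx
        by_cases hxu : G.Adj x u
        · exact Or.inl (nbr hu hxu h1)
        by_cases hxv : G.Adj x v
        · exact Or.inl (nbr hv hxv h2)
        exact Or.inr ⟨u, Finset.mem_filter.2 ⟨hu, hux, hxu⟩, v,
          Finset.mem_filter.2 ⟨hv, hvx, hxv⟩, huv, h1, h2⟩
  · intro m
    constructor
    · rintro (⟨a, ha, hma⟩ | ⟨u, hu, v, hv, h⟩)
      · rcases Finset.mem_insert.1 ha with rfl | ha
        · exact Or.inr hma
        · exact Or.inl (Or.inl ⟨a, ha, hma⟩)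
      · exact Or.inl (Or.inr ⟨u, Finset.mem_of_mem_erase hu, v, Finset.mem_of_mem_erase hv, h⟩)
    · rintro ((⟨a, ha, hma⟩ | ⟨u, hu, v, hv, huv, h1, h2⟩) | h)
      · exact Or.inl ⟨a, Finset.mem_insert_of_mem ha, hma⟩
      · rcases eq_or_ne u x with rfl | hux
        · exact Or.inl ⟨u, Finset.mem_insert_self _ _, h1⟩
        rcases eq_or_ne v x with rfl | hvx
        · exact Or.inl ⟨v, Finset.mem_insert_self _ _, h2⟩
        exact Or.inr ⟨u, Finset.mem_erase.2 ⟨hux, hu⟩, v, Finset.mem_erase.2 ⟨hvx, hv⟩, huv, h1, h2⟩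
      · exact Or.inl ⟨x, Finset.mem_insert_self _ _, h⟩

end EdgeSupport

/-! ### Neighbourhoods in claw-free graphs -/

theorem IsClawFree.adj_of_nbrs {V : Type*} {G : SimpleGraph V} (hG : IsClawFree G)
    {y a b c : V} (ha : G.Adj y a) (hb : G.Adj y b) (hc : G.Adj y c) (hab : a ≠ b) (hac : a ≠ c)
    (hbc : b ≠ c) : G.Adj a b ∨ G.Adj a c ∨ G.Adj b c := by
  by_contra! h
  obtain ⟨h1, h2, h3⟩ := h
  have h1' := G.adj_comm _ _ |>.not.1 h1
  have h2' := G.adj_comm _ _ |>.not.1 h2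
  have h3' := G.adj_comm _ _ |>.not.1 h3
  have hinj : Function.Injective (Sum.elim (fun _ : Fin 1 => y) ![a, b, c]) := by
    rintro (i | i) (j | j) hij
    · rw [Subsingleton.elim i j]
    · fin_cases j <;> simp_all
    · fin_cases i <;> simp_all
    · fin_cases i <;> fin_cases j <;> simp_all
  have hadj (i j : Fin 1 ⊕ Fin 3) : G.Adj (Sum.elim (fun _ : Fin 1 => y) ![a, b, c] i)
      (Sum.elim (fun _ : Fin 1 => y) ![a, b, c] j) ↔ clawGraph.Adj i j := by
    rcases i with i | i <;> rcases j with j | j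
    · simp
    · fin_cases j <;> simp [ha, hb, hc]
    · fin_cases i <;> simp [ha.symm, hb.symm, hc.symm]
    · fin_cases i <;> fin_cases j <;> simp [h1, h2, h3, h1', h2', h3']
  exact hG ⟨⟨⟨_, hinj⟩, hadj _ _⟩⟩

section

variable {V : Type*} [DecidableEq V] (G : SimpleGraph V) [DecidableRel G.Adj]

/-- If the complement of `G` has no triangle in `S`, then some vertex of `S` has at most `|S| / 2`
non-neighbours in `S`. -/
theorem exists_card_nonadj_le_half {S : Finset V} (hS : S.Nonempty)
    (h : ∀ a ∈ S, ∀ b ∈ S, ∀ c ∈ S, a ≠ b → a ≠ c → b ≠ c →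
      G.Adj a b ∨ G.Adj a c ∨ G.Adj b c) :
    ∃ z ∈ S, (S.filter fun w => w ≠ z ∧ ¬ G.Adj z w).card ≤ S.card / 2 := by
  by_cases hp : ∃ z ∈ S, ∃ w ∈ S, z ≠ w ∧ ¬ G.Adj z w
  · obtain ⟨z, hz, w, hw, hzw, hadj⟩ := hp
    -- A common non-neighbour of `z` and `w` would complete an independent triple; disjointness
    -- makes one of the two sets at most half of `S`.
    have hdisj : Disjoint (S.filter fun t => t ≠ z ∧ ¬ G.Adj z t)
        (S.filter fun t => t ≠ w ∧ ¬ G.Adj w t) := by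
      rw [Finset.disjoint_filter]
      rintro t ht ⟨htz, hzt⟩ ⟨htw, hwt⟩
      rcases h z hz w hw t ht hzw htz.symm htw.symm with h | h | h
      exacts [hadj h, hzt h, hwt h]
    have hle := Finset.card_le_card (Finset.union_subset
      (Finset.filter_subset (fun t => t ≠ z ∧ ¬ G.Adj z t) S)
      (Finset.filter_subset (fun t => t ≠ w ∧ ¬ G.Adj w t) S))
    rw [Finset.card_union_of_disjoint hdisj] at hle
    by_cases hc : (S.filter fun t => t ≠ z ∧ ¬ G.Adj z t).card ≤ S.card / 2
    · exact ⟨z, hz, hc⟩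
    · exact ⟨w, hw, by omega⟩
  · push Not at hp
    obtain ⟨z, hz⟩ := hS
    refine ⟨z, hz, ?_⟩
    rw [Finset.filter_false_of_mem]
    · simp
    · rintro w hw ⟨hwz, hzw⟩
      exact hzw (hp z hz w hw hwz.symm)

/-! ### The induction on states -/

variable (k : Type*) [Field k]

/-- To bound the projective dimension one may delete the part `S` of the neighbourhood of a vertex
`y`, provided that the bound holds for all the smaller graphs in which at most `C` vertices have
been lost and one of those vertices has become free. -/
theorem partialEdgeIdealPDLE_of_delete_nbrs [Fintype V] (hG : IsClawFree G) {C n : ℕ}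
    (hC : ∀ x y, G.Adj x y → G.degree x + G.degree y / 2 + 1 ≤ C) {W A : Finset V}
    (hWA : Disjoint W A) (y : V)
    (ih : ∀ W' A' : Finset V, Disjoint W' A' → W'.card < W.card →
      A'.card + W'.card + 1 = A.card + W.card → W.card ≤ W'.card + C →
      PartialEdgeIdealPDLE G k W' A' n) (S : Finset V) (hSW : S ⊆ W) (hSy : ∀ s ∈ S, G.Adj y s)
    (hS : PartialEdgeIdealPDLE G k (W \ S) (A ∪ S) n) :
    PartialEdgeIdealPDLE G k W A n := by
  induction hcard : S.card generalizing S with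
  | zero => simpa [Finset.card_eq_zero.1 hcard] using hS
  | succ r ihr =>
    obtain ⟨z, hz, hzc⟩ := exists_card_nonadj_le_half G (S := S)
      (Finset.card_pos.1 (by omega)) fun a ha b hb c hc hab hac hbc =>
        hG.adj_of_nbrs (hSy a ha) (hSy b hb) (hSy c hc) hab hac hbc
    have hzW : z ∈ W := hSW hz
    have hzA : z ∉ A := Finset.disjoint_left.1 hWA hzW
    -- Deletions are undone from the last: `z` is restored to `W`, and splitting at `z` has the
    -- given state `hS` as its deletion branch.
    refine ihr (S.erase z) ((S.erase_subset z).trans hSW)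
      (fun s hs => hSy s (Finset.mem_of_mem_erase hs)) ?_ (by simp [Finset.card_erase_of_mem hz, hcard])
    refine partialEdgeIdealPDLE_of_mem G k (x := z) (by simp [hzW]) (by simp [hzA]) ?_ ?_
    · set W' := (W \ S.erase z).filter fun w => w ≠ z ∧ ¬ G.Adj z w with hW'
      set A' := A ∪ S.erase z ∪ (W \ S.erase z).filter (G.Adj z) with hA'
      have hdisj : Disjoint W' A' := by
        rw [Finset.disjoint_left] at hWA ⊢
        intro v
        simp only [hW', hA', Finset.mem_filter, Finset.mem_union, Finset.mem_sdiff]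
        have := @hWA v
        tauto
      have hzW' : z ∉ W' ∪ A' := by simp [hW', hA', hzA]
      have hunion : insert z (W' ∪ A') = A ∪ W := by
        ext v
        simp only [hW', hA', Finset.mem_insert, Finset.mem_filter, Finset.mem_union,
          Finset.mem_sdiff, Finset.mem_erase]
        have := @hSW v
        by_cases hv : v = z
        · subst hv; tauto
        · tauto
      have h1 := congrArg Finset.card hunion
      rw [Finset.card_insert_of_notMem hzW', Finset.card_union_of_disjoint hdisj,
        Finset.card_union_of_disjoint hWA.symm] at h1
      -- The vertices of `S` adjacent to `z` are already counted in `deg z`; only the non-neighbours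
      -- of `z` in `S` cost extra.
      have hlost : W ⊆ W' ∪ insert z (G.neighborFinset z ∪
          S.filter fun w => w ≠ z ∧ ¬ G.Adj z w) := by
        intro v hv
        simp only [hW', Finset.mem_insert, Finset.mem_filter, Finset.mem_union,
          Finset.mem_sdiff, Finset.mem_erase, SimpleGraph.mem_neighborFinset]
        tauto
      have h2 := (Finset.card_le_card hlost).trans ((Finset.card_union_le _ _).trans
        (Nat.add_le_add_left ((Finset.card_insert_le _ _).trans
          (Nat.add_le_add_right (Finset.card_union_le _ _) 1)) _))
      rw [SimpleGraph.card_neighborFinset_eq_degree] at h2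
      have hSdeg : S.card ≤ G.degree y := by
        rw [← SimpleGraph.card_neighborFinset_eq_degree]
        exact Finset.card_le_card fun s hs => by simpa using hSy s hs
      have h3 := hC z y (hSy z hz).symm
      have h4 : W'.card < W.card := by
        refine Finset.card_lt_card (Finset.ssubset_iff_of_subset ?_ |>.2 ⟨z, hzW, by simp [hW']⟩)
        exact (Finset.filter_subset _ _).trans Finset.sdiff_subset
      exact ih W' A' hdisj h4 (by omega) (by omega)
    · convert hS using 1
      · ext v
        simp only [Finset.mem_erase, Finset.mem_sdiff]
        by_cases hv : v = z
        · subst hv; tauto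
        · tauto
      · rw [← Finset.union_insert, Finset.insert_erase hz]

/-- Hypothesis `hn` is `|A| + |W| (1 - 1/C) < n + 1` cleared of denominators. A colon step subtracts
`C` on the left and at most `C` on the right. -/
theorem IsClawFree.partialEdgeIdealPDLE [Fintype V] (hG : IsClawFree G) {C n : ℕ}
    (hC : ∀ x y, G.Adj x y → G.degree x + G.degree y / 2 + 1 ≤ C) (hC0 : 0 < C)
    (W A : Finset V) (hWA : Disjoint W A)
    (hn : C * (A.card + W.card) < C * (n + 1) + W.card) :
    PartialEdgeIdealPDLE G k W A n := by
  induction hr : W.card using Nat.strong_induction_on generalizing W A with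
  | _ r ih =>
    subst hr
    have ih' (W' A' : Finset V) (hd : Disjoint W' A') (hlt : W'.card < W.card)
        (hsum : A'.card + W'.card + 1 = A.card + W.card) (hle : W.card ≤ W'.card + C) :
        PartialEdgeIdealPDLE G k W' A' n := by
      refine ih _ hlt W' A' hd ?_ rfl
      rw [← hsum] at hn
      linarith
    by_cases hE : ∃ u ∈ W, ∃ v ∈ W, G.Adj u v
    · obtain ⟨y, hy, v, hv, hyv⟩ := hE
      have hyA : y ∉ A := Finset.disjoint_left.1 hWA hy
      refine partialEdgeIdealPDLE_of_delete_nbrs G k hG hC hWA y ih' (W.filter (G.Adj y))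
        (Finset.filter_subset _ _) (fun s hs => (Finset.mem_filter.1 hs).2) ?_
      set W' := W.filter fun w => w ≠ y ∧ ¬ G.Adj y w with hW'
      set A' := A ∪ W.filter (G.Adj y) with hA'
      -- Once its neighbours are deleted, `y` is isolated, so it can leave `W` without entering `A`:
      -- this frees `y` without a colon step.
      have hsupp : edgeSupport G W' A' = edgeSupport G (W \ W.filter (G.Adj y)) A' := by
        ext m
        refine or_congr_right ⟨?_, ?_⟩
        · rintro ⟨u, hu, v, hv, h⟩
          rw [Finset.mem_filter] at hu hv
          exact ⟨u, by simp [hu], v, by simp [hv], h⟩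
        · rintro ⟨u, hu, v, hv, huv, h⟩
          simp only [Finset.mem_sdiff, Finset.mem_filter, not_and] at hu hv
          refine ⟨u, Finset.mem_filter.2 ⟨hu.1, ?_, hu.2 hu.1⟩, v,
            Finset.mem_filter.2 ⟨hv.1, ?_, hv.2 hv.1⟩, huv, h⟩
          · rintro rfl
            exact hv.2 hv.1 huv
          · rintro rfl
            exact hu.2 hu.1 huv.symm
      rw [← partialEdgeIdealPDLE_congr G k hsupp]
      have hdisj : Disjoint W' A' := by
        rw [Finset.disjoint_left] at hWA ⊢
        intro v
        simp only [hW', hA', Finset.mem_filter, Finset.mem_union]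
        have := @hWA v
        tauto
      have hyW' : y ∉ W' ∪ A' := by simp [hW', hA', hyA]
      have hunion : insert y (W' ∪ A') = A ∪ W := by
        ext v
        simp only [hW', hA', Finset.mem_insert, Finset.mem_filter, Finset.mem_union]
        by_cases hv : v = y
        · subst hv; tauto
        · tauto
      have h1 := congrArg Finset.card hunion
      rw [Finset.card_insert_of_notMem hyW', Finset.card_union_of_disjoint hdisj,
        Finset.card_union_of_disjoint hWA.symm] at h1
      have hlost : W ⊆ W' ∪ insert y (G.neighborFinset y) := by
        intro v hv
        simp only [hW', Finset.mem_insert, Finset.mem_filter, Finset.mem_union,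
          SimpleGraph.mem_neighborFinset]
        tauto
      have h2 := (Finset.card_le_card hlost).trans ((Finset.card_union_le _ _).trans
        (Nat.add_le_add_left (Finset.card_insert_le _ _) _))
      rw [SimpleGraph.card_neighborFinset_eq_degree] at h2
      have h3 := hC y v hyv
      have h4 : W'.card < W.card :=
        Finset.card_lt_card (Finset.ssubset_iff_of_subset (Finset.filter_subset _ _) |>.2
          ⟨y, hy, by simp⟩)
      exact ih' W' A' hdisj h4 (by omega) (by omega)
    · push Not at hE
      refine (partialEdgeIdealPDLE_of_no_edges G k hE).mono G k ?_
      have h1 : W.card ≤ C * W.card := Nat.le_mul_of_pos_left _ hC0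
      have h2 : C * A.card < C * (n + 1) := by linarith
      exact Nat.lt_succ_iff.1 (Nat.lt_of_mul_lt_mul_left h2)

end

/-! ### The numerical bound -/

theorem edgeIdeal_ne_top (k : Type*) [Field k] {V : Type*} [Fintype V] (G : SimpleGraph V) :
    edgeIdeal k G ≠ ⊤ := by
  rw [Ideal.ne_top_iff_one, edgeIdeal_eq_partialEdgeIdeal]
  intro h
  have := (mem_restrictSupportIdeal_iff k _ _).1 h 0 (by simp)
  simp [edgeSupport] at this

theorem mainTheorem5 (k : Type*) [Field k] {V : Type*} [Fintype V] (G : SimpleGraph V)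
    [DecidableRel G.Adj] (hG : IsClawFree G) (C : ℕ) (hC : IsGreatest (edgeDegreeValues G) C) :
    ∃ p : ℕ, edgeIdealQuotientPD k G = (p : WithBot ℕ∞) ∧
      (p : ℝ) ≤ (Fintype.card V : ℝ) * (1 - 1 / (C : ℝ)) := by
  classical
  have hC0 : 0 < C := by
    obtain ⟨x, y, -, rfl⟩ := hC.1
    omega
  have hdeg (x y : V) (h : G.Adj x y) : G.degree x + G.degree y / 2 + 1 ≤ C :=
    hC.2 ⟨x, y, h, rfl⟩
  -- The integer part of `n (1 - 1/C)`, the least value that `hn` allows when `W` is everything and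
  -- `A` is empty.
  set N := (C - 1) * Fintype.card V / C with hN
  have hlt : (C - 1) * Fintype.card V < C * (N + 1) := by
    exact Nat.lt_mul_div_succ _ hC0
  have hsplit : C * Fintype.card V = (C - 1) * Fintype.card V + Fintype.card V := by
    rw [← Nat.succ_mul, Nat.succ_eq_add_one, Nat.sub_add_cancel hC0]
  have hpd := hG.partialEdgeIdealPDLE G k hdeg hC0 Finset.univ ∅ (by simp) (n := N)
    (by rw [Finset.card_empty, zero_add, Finset.card_univ]; omega)
  rw [PartialEdgeIdealPDLE, ← edgeIdeal_eq_partialEdgeIdeal, ← projectiveDimension_le_iff] at hpd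
  change edgeIdealQuotientPD k G ≤ _ at hpd
  have hbot : edgeIdealQuotientPD k G ≠ ⊥ := by
    rw [edgeIdealQuotientPD, Ne, projectiveDimension_eq_bot_iff, ModuleCat.isZero_iff_subsingleton]
    intro h
    exact edgeIdeal_ne_top k G (Ideal.Quotient.subsingleton_iff.1 h)
  obtain ⟨e, he⟩ := WithBot.ne_bot_iff_exists.1 hbot
  rw [← he] at hpd ⊢
  have heN : e ≤ (N : ℕ∞) := WithBot.coe_le_coe.1 hpd
  lift e to ℕ using ne_top_of_le_ne_top (ENat.natCast_ne_top N) heN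
  refine ⟨e, rfl, ?_⟩
  have heN' : e ≤ N := by exact_mod_cast heN
  have hmul : e * C ≤ (C - 1) * Fintype.card V :=
    (Nat.mul_le_mul_right C heN').trans (Nat.div_mul_le_self _ _)
  have hreal : (e : ℝ) * C ≤ C * Fintype.card V - Fintype.card V := by
    have : e * C + Fintype.card V ≤ C * Fintype.card V := by omega
    have : (e : ℝ) * C + Fintype.card V ≤ C * Fintype.card V := by exact_mod_cast this
    linarith
  have hCpos : (0 : ℝ) < C := by exact_mod_cast hC0
  rw [← mul_le_mul_iff_left₀ hCpos]
  refine hreal.trans (le_of_eq ?_)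
  field_simp
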